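/- For a partition $\lambda\vdash n$, viewed as a Young diagram in English notation, let $\mathrm{SYT}(\lambda)$ be the set of standard Young tableaux of shape $\lambda$ and $\dim\lambda=|\mathrm{SYT}(\lambda)|$. For $T\in\mathrm{SYT}(\lambda)$ let $c_k(T)$ be the content (column index minus row index) of the box of $T$ containing $k$, and for $1\le k\le n-1$ put $d_k(T)=c_{k+1}(T)-c_k(T)$. Let $\pi^\lambda$ be Young's seminormal representation of the symmetric group $S_n$, that is, the real matrix representation with rows and columns indexed by $\mathrm{SYT}(\lambda)$ that is determined by \[ \pi^\lambda((k,k+1))_{T,S}=\begin{cases}1/d_k(T)&\text{if }T=S,\\ \sqrt{1-1/d_k(T)^2}&\text{if } S \text{ is obtained from } T \text{ by exchanging } k \text{ and } k+1,\\ 0&\text{otherwise.}\end{cases} \] For $\sigma\in S_n$ define the normalized character and the normalized total sum by \[ \hat\chi^\lambda(\sigma)=\frac{1}{\dim\lambda}\sum_{T\in\mathrm{SYT}(\lambda)}\pi^\lambda(\sigma)_{T,T},\qquad TS^\lambda(\sigma)=\frac{1}{\dim\lambda}\sum_{T,S\in\mathrm{SYT}(\lambda)}\pi^\lambda(\sigma)_{T,S}.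 \] For $r\le n$ regard $S_r$ as a subgroup of $S_n$ by adding fixed points, so that $\hat\chi^\lambda(\tau)$ and $TS^\lambda(\tau)$ are defined for $\tau\in S_r$. For a real function $X$ on the partitions of $r$ write \[ \mathbb{E}^r_{PL}[X^\nu]=\sum_{\nu\vdash r}\frac{(\dim\nu)^2}{r!}\,X^\nu \] for its average with respect to the Plancherel measure of size $r$. \textbf{Proposition.} Let $r\le n$, $\sigma\in S_r$ and $\lambda\vdash n$. Then \[ TS^\lambda(\sigma)=\sum_{\tau\in S_r}\mathbb{E}^r_{PL}\big[\hat\chi^\nu(\tau)\,TS^\nu(\sigma)\big]\;\hat\chi^\lambda(\tau). \] -/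

import Mathlib

namespace Seminormal

/-- Young diagrams with `n` boxes, i.e. partitions of `n`. The box `(i, j)` of a diagram lies in
row `i` and column `j`, both counted from `0` (English notation). -/
abbrev DiagramOfSize (n : ℕ) : Type := {μ : YoungDiagram // μ.card = n}

theorem cells_subset_of_card {n : ℕ} (μ : YoungDiagram) (h : μ.card = n) :
    μ.cells ⊆ Finset.range n ×ˢ Finset.range n := by
  rintro ⟨i, j⟩ hc
  have hc' : (i, j) ∈ μ := hc
  have h1 : μ.colLen j ≤ n := by
    rw [← h, YoungDiagram.colLen_eq_card]
    exact Finset.card_le_card (Finset.filter_subset _ _)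
  have h2 : μ.rowLen i ≤ n := by
    rw [← h, YoungDiagram.rowLen_eq_card]
    exact Finset.card_le_card (Finset.filter_subset _ _)
  have h3 := YoungDiagram.mem_iff_lt_colLen.1 hc'
  have h4 := YoungDiagram.mem_iff_lt_rowLen.1 hc'
  simp only [Finset.mem_product, Finset.mem_range]
  omega

instance finite_diagramOfSize (n : ℕ) : Finite (DiagramOfSize n) := by
  refine Finite.of_injective
    (fun μ : DiagramOfSize n =>
      (⟨μ.1.cells, Finset.mem_powerset.2 (cells_subset_of_card μ.1 μ.2)⟩ :
        {s // s ∈ (Finset.range n ×ˢ Finset.range n).powerset})) ?_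
  intro μ ν hμν
  exact Subtype.ext (YoungDiagram.ext (congrArg Subtype.val hμν))

noncomputable instance fintype_diagramOfSize (n : ℕ) : Fintype (DiagramOfSize n) :=
  Fintype.ofFinite _

/-- Standard Young tableaux of shape `μ` with entries in `Fin n` (so the usual entry `k + 1` is
written `k`). A tableau is a bijection `T` sending each entry to the box that contains it, such
that the entries increase along rows and down columns; equivalently, they are monotone for the
componentwise order of boxes. There is none unless `μ` has exactly `n` boxes. -/
def SYT (μ : YoungDiagram) (n : ℕ) : Type :=
  {T : Fin n ≃ {c // c ∈ μ.cells} // ∀ a b, a.1 ≤ b.1 → T.symm a ≤ T.symm b}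

instance fintype_SYT (μ : YoungDiagram) (n : ℕ) : Fintype (SYT μ n) := by
  unfold SYT; infer_instance

instance decidableEq_SYT (μ : YoungDiagram) (n : ℕ) : DecidableEq (SYT μ n) := by
  unfold SYT; infer_instance

/-- `dim μ`, the number of standard Young tableaux of shape `μ`. -/
def dim (μ : YoungDiagram) : ℕ := Fintype.card (SYT μ μ.card)

/-- The content of a box: column index minus row index. -/
def content (c : ℕ × ℕ) : ℤ := (c.2 : ℤ) - (c.1 : ℤ)

/-- The first of the two letters exchanged by the `k`-th adjacent transposition. -/
def lo {n : ℕ} (k : Fin (n - 1)) : Fin n := ⟨k.1, by omega⟩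

/-- The second of the two letters exchanged by the `k`-th adjacent transposition. -/
def hi {n : ℕ} (k : Fin (n - 1)) : Fin n := ⟨k.1 + 1, by omega⟩

/-- The `k`-th adjacent transposition; the `n - 1` of them generate the symmetric group. -/
def adj {n : ℕ} (k : Fin (n - 1)) : Equiv.Perm (Fin n) := Equiv.swap (lo k) (hi k)

/-- The signed distance between two consecutive entries of `T`: the content of the box of the
larger entry minus the content of the box of the smaller one. -/
def dist {μ : YoungDiagram} {n : ℕ} (T : SYT μ n) (k : Fin (n - 1)) : ℤ :=
  content (T.1 (hi k)).1 - content (T.1 (lo k)).1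

/-- The matrix of the `k`-th adjacent transposition in Young's seminormal representation.
The condition `(adj k).trans T.1 = S.1` says that `S` is `T` with its `k`-th and `(k+1)`-st
entries exchanged. -/
noncomputable def genMatrix (μ : YoungDiagram) {n : ℕ} (k : Fin (n - 1)) :
    Matrix (SYT μ n) (SYT μ n) ℝ :=
  Matrix.of fun T S =>
    if T = S then 1 / (dist T k : ℝ)
    else if (adj k).trans T.1 = S.1 then Real.sqrt (1 - 1 / (dist T k : ℝ) ^ 2)
    else 0

/-- Every permutation is a product of adjacent transpositions. -/
theorem exists_word {n : ℕ} (σ : Equiv.Perm (Fin n)) :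
    ∃ w : List (Fin (n - 1)), (w.map adj).prod = σ := by
  cases n with
  | zero => exact ⟨[], Subsingleton.elim _ _⟩
  | succ m =>
    have hσ : σ ∈ Submonoid.closure
        (Set.range fun i : Fin m => Equiv.swap i.castSucc i.succ) := by
      rw [Equiv.Perm.mclosure_swap_castSucc_succ]; trivial
    obtain ⟨l, hl, rfl⟩ := Submonoid.exists_list_of_mem_closure hσ
    clear hσ
    induction l with
    | nil => exact ⟨[], rfl⟩
    | cons a l ih =>
      obtain ⟨w, hw⟩ := ih fun y hy => hl y (List.mem_cons_of_mem _ hy)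
      obtain ⟨i, hi⟩ := hl a List.mem_cons_self
      exact ⟨i :: w, by rw [List.map_cons, List.prod_cons, List.prod_cons, hw, ← hi]; rfl⟩

/-- A decomposition of `σ` as a product of adjacent transpositions. -/
noncomputable def word {n : ℕ} (σ : Equiv.Perm (Fin n)) : List (Fin (n - 1)) :=
  (exists_word σ).choose

/-- The matrix of `σ` in Young's seminormal representation of shape `μ`: decompose `σ` into
adjacent transpositions and multiply their matrices. The matrices of the adjacent transpositions
satisfy the Coxeter relations, so the product does not depend on the decomposition. -/
noncomputable def repMatrix (μ : YoungDiagram) {n : ℕ} (σ : Equiv.Perm (Fin n)) :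
    Matrix (SYT μ n) (SYT μ n) ℝ :=
  ((word σ).map (genMatrix μ)).prod

/-- The normalized character: the trace of the representation matrix divided by the dimension. -/
noncomputable def normChar (μ : YoungDiagram) {n : ℕ} (σ : Equiv.Perm (Fin n)) : ℝ :=
  (repMatrix μ σ).trace / (dim μ : ℝ)

/-- The normalized total sum: the sum of all entries of the representation matrix divided by the
dimension. -/
noncomputable def totalSum (μ : YoungDiagram) {n : ℕ} (σ : Equiv.Perm (Fin n)) : ℝ :=
  (∑ T : SYT μ n, ∑ S : SYT μ n, repMatrix μ σ T S) / (dim μ : ℝ)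

/-- The average of `X` with respect to the Plancherel measure of size `r`, which gives the
partition `ν` of `r` the weight `(dim ν)² / r!`. -/
noncomputable def plancherelExp (r : ℕ) (X : YoungDiagram → ℝ) : ℝ :=
  ∑ ν : DiagramOfSize r, ((dim ν.1 : ℝ) ^ 2 / (r.factorial : ℝ)) * X ν.1

/-- The inclusion of the symmetric group on `r` letters in the one on `n ≥ r` letters, by adding
fixed points. -/
noncomputable def incl {r n : ℕ} (h : r ≤ n) : Equiv.Perm (Fin r) →* Equiv.Perm (Fin n) :=
  Equiv.Perm.viaEmbeddingHom (Fin.castLEEmb h)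

end Seminormal

/-! Group the tableaux of shape λ by the positions of the entries after the first r. For this
grouping the restriction of π^λ to S_r is block diagonal, and each block is literally the matrix of
π^ν, where ν is the shape filled by the first r entries (`graftMatrix_mul_repMatrix`). Hence both
the trace and the sum of all entries of `incl τ` are sums over blocks. The Plancherel weight cancels
the normalizations, so with s^κ(σ) the entry sum of π^κ(σ) it remains to see, block by block, that
the sum of χ^κ(τ) s^κ(σ) χ^ν(τ) / r! over κ and τ is s^ν(σ). This is orthogonality of characters:
only κ = ν survives.

Orthogonality comes from averaging matrix units and Schur's lemma. For the latter, the diagonal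
matrices of contents are the Jucys–Murphy elements, given by one recursion in the generators for all
shapes, so an intertwiner commutes with them. A tableau is determined by its contents, so
intertwiners between different shapes vanish and self-intertwiners are diagonal, then scalar.

As `repMatrix` is defined by a chosen word, its multiplicativity needs the Coxeter relations for
Young's matrices and the fact that these relations present the symmetric group
(`prod_eq_of_prod_adj_eq`). -/

namespace Seminormal

/-! ### The Coxeter relations present the symmetric group -/

section WordProblem

variable {M : Type*} [Monoid M]

/-- The submonoid generated by the first `m` terms of a sequence. -/
def initialSubmonoid (t : ℕ → M) (m : ℕ) : Submonoid M :=
  Submonoid.closure (t '' Set.Iio m)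

/-- The descending products `t (m - 1) * t (m - 2) * ⋯ * t j`, including the empty one. -/
def descendingProducts (t : ℕ → M) : ℕ → Set M
  | 0 => {1}
  | m + 1 => insert 1 ((fun c => t m * c) '' descendingProducts t m)

theorem one_mem_descendingProducts (t : ℕ → M) (m : ℕ) : 1 ∈ descendingProducts t m := by
  cases m <;> simp [descendingProducts]

theorem mem_initialSubmonoid {t : ℕ → M} {i m : ℕ} (h : i < m) : t i ∈ initialSubmonoid t m :=
  Submonoid.subset_closure ⟨i, h, rfl⟩

theorem initialSubmonoid_mono (t : ℕ → M) {m k : ℕ} (h : m ≤ k) :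
    initialSubmonoid t m ≤ initialSubmonoid t k :=
  Submonoid.closure_mono (Set.image_mono (Set.Iio_subset_Iio h))

theorem descendingProducts_subset (t : ℕ → M) (m : ℕ) :
    descendingProducts t m ⊆ initialSubmonoid t m := by
  induction m with
  | zero => rintro _ rfl; exact one_mem _
  | succ m ih =>
    rintro _ (rfl | ⟨c, hc, rfl⟩)
    · exact one_mem _
    · exact mul_mem (mem_initialSubmonoid m.lt_succ_self)
        (initialSubmonoid_mono t m.le_succ (ih hc))

/-- The Coxeter relations of type `A` for the first `N` terms of a sequence. -/
structure CoxeterRelations (t : ℕ → M) (N : ℕ) : Prop where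
  sq : ∀ i < N, t i * t i = 1
  braid : ∀ i, i + 1 < N → t i * t (i + 1) * t i = t (i + 1) * t i * t (i + 1)
  comm : ∀ i j, i + 1 < j → j < N → t i * t j = t j * t i

variable {t : ℕ → M} {N : ℕ}

theorem CoxeterRelations.commute (H : CoxeterRelations t N) {m k : ℕ} (hmk : m < k) (hk : k < N)
    {u : M} (hu : u ∈ initialSubmonoid t m) : u * t k = t k * u := by
  induction hu using Submonoid.closure_induction with
  | mem x hx =>
    obtain ⟨i, hi, rfl⟩ := hx
    exact H.comm i k (by simp only [Set.mem_Iio] at hi; omega) hk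
  | one => simp
  | mul x y _ _ hx hy => rw [mul_assoc, hy, ← mul_assoc, hx, mul_assoc]

/-- Peel off the top generator. A lower generator is absorbed by the rest of the product, and what
comes out on the left commutes with the top one. The top generator itself cancels, or crosses by the
braid relation and emerges on the left one index lower. -/
theorem CoxeterRelations.descending_mul (H : CoxeterRelations t N) (m : ℕ) (hm : m + 1 ≤ N)
    {c : M} (hc : c ∈ descendingProducts t (m + 1)) (i : ℕ) (hi : i < m + 1) :
    ∃ u ∈ initialSubmonoid t m, ∃ d ∈ descendingProducts t (m + 1), c * t i = u * d := by
  induction m generalizing c i with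
  | zero =>
    obtain rfl : i = 0 := by omega
    rcases hc with rfl | ⟨c, rfl, rfl⟩
    · exact ⟨1, one_mem _, t 0, Or.inr ⟨1, rfl, mul_one _⟩, rfl⟩
    · exact ⟨1, one_mem _, 1, Or.inl rfl, by simp [H.sq 0 (by omega)]⟩
  | succ m ih =>
    rcases hc with rfl | ⟨c, hc, rfl⟩
    · rcases Nat.lt_succ_iff_lt_or_eq.1 hi with hi | rfl
      · exact ⟨t i, mem_initialSubmonoid hi, 1, Or.inl rfl, by simp⟩
      · exact ⟨1, one_mem _, t (m + 1), Or.inr ⟨1, one_mem_descendingProducts _ _, mul_one _⟩, rfl⟩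
    · rcases Nat.lt_succ_iff_lt_or_eq.1 hi with hi | rfl
      · obtain ⟨u, hu, d, hd, e⟩ := ih (by omega) hc i hi
        refine ⟨u, initialSubmonoid_mono t m.le_succ hu, t (m + 1) * d, Or.inr ⟨d, hd, rfl⟩, ?_⟩
        rw [mul_assoc, e, ← mul_assoc, ← H.commute m.lt_succ_self (by omega) hu, mul_assoc]
      · rcases hc with rfl | ⟨c, hc, rfl⟩
        · exact ⟨1, one_mem _, 1, Or.inl rfl, by simp [H.sq (m + 1) (by omega)]⟩
        · refine ⟨t m, mem_initialSubmonoid m.lt_succ_self, t (m + 1) * (t m * c),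
            Or.inr ⟨_, Or.inr ⟨c, hc, rfl⟩, rfl⟩, ?_⟩
          have e := H.commute m.lt_succ_self (by omega) (descendingProducts_subset t m hc)
          calc t (m + 1) * (t m * c) * t (m + 1) = t (m + 1) * t m * (c * t (m + 1)) := by
                simp only [mul_assoc]
            _ = t (m + 1) * t m * t (m + 1) * c := by rw [e]; simp only [mul_assoc]
            _ = t m * (t (m + 1) * (t m * c)) := by
                rw [← H.braid m (by omega)]; simp only [mul_assoc]

/-- Descending products represent all right cosets of the submonoid with one generator fewer. -/
theorem CoxeterRelations.exists_normal_form (H : CoxeterRelations t N) (m : ℕ) (hm : m + 1 ≤ N)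
    {x : M} (hx : x ∈ initialSubmonoid t (m + 1)) :
    ∃ u ∈ initialSubmonoid t m, ∃ d ∈ descendingProducts t (m + 1), x = u * d := by
  induction hx using Submonoid.closure_induction_right with
  | one => exact ⟨1, one_mem _, 1, Or.inl rfl, by simp⟩
  | mul_right x _ y hy ih =>
    obtain ⟨u, hu, d, hd, rfl⟩ := ih
    obtain ⟨i, hi, rfl⟩ := hy
    obtain ⟨v, hv, d', hd', e⟩ := H.descending_mul m hm hd i hi
    exact ⟨u * v, mul_mem hu hv, d', hd', by rw [mul_assoc, e, mul_assoc]⟩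

/-- In the normal form u * d, a nontrivial d sends a smaller point to the last one, which u fixes;
so a product acting trivially has d = 1, and induction applies to u. -/
theorem eq_one_of_perm_eq_one (H : CoxeterRelations t N) (φ : M →* Equiv.Perm ℕ)
    (hφ : ∀ i < N, φ (t i) = Equiv.swap i (i + 1)) (m : ℕ) (hm : m ≤ N) {x : M}
    (hx : x ∈ initialSubmonoid t m) (h : φ x = 1) : x = 1 := by
  have fixes : ∀ m ≤ N, ∀ u ∈ initialSubmonoid t m, ∀ j, m < j → φ u j = j := by
    intro m hm u hu
    induction hu using Submonoid.closure_induction with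
    | mem x hx =>
      obtain ⟨i, hi, rfl⟩ := hx
      simp only [Set.mem_Iio] at hi
      intro j hj
      rw [hφ i (by omega), Equiv.swap_apply_of_ne_of_ne (by omega) (by omega)]
    | one => simp
    | mul x y _ _ hx hy => intro j hj; rw [map_mul, Equiv.Perm.mul_apply, hy j hj, hx j hj]
  have moves : ∀ m ≤ N, ∀ c ∈ descendingProducts t m, c = 1 ∨ ∃ j < m, φ c j = m := by
    intro m
    induction m with
    | zero => exact fun _ c hc => Or.inl hc
    | succ m ih =>
      rintro hm _ (rfl | ⟨c, hc, rfl⟩)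
      · exact Or.inl rfl
      · refine Or.inr ?_
        rcases ih (by omega) c hc with rfl | ⟨j, hj, e⟩
        · exact ⟨m, m.lt_succ_self, by simp [hφ m (by omega)]⟩
        · exact ⟨j, by omega, by simp [hφ m (by omega), e]⟩
  induction m generalizing x with
  | zero => simpa [initialSubmonoid] using hx
  | succ m ih =>
    obtain ⟨u, hu, d, hd, rfl⟩ := H.exists_normal_form m hm hx
    rcases moves _ hm d hd with rfl | ⟨j, hj, e⟩
    · rw [mul_one] at h ⊢
      exact ih (by omega) hu h
    · have := congrArg (fun p : Equiv.Perm ℕ => p j) h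
      simp only [map_mul, Equiv.Perm.mul_apply, e, Equiv.Perm.one_apply,
        fixes m (by omega) u hu (m + 1) m.lt_succ_self] at this
      omega

end WordProblem

theorem viaEmbedding_swap {α β : Type*} [DecidableEq α] [DecidableEq β] (ι : α ↪ β) (a b : α) :
    (Equiv.swap a b).viaEmbedding ι = Equiv.swap (ι a) (ι b) := by
  ext x
  by_cases hx : x ∈ Set.range ι
  · obtain ⟨y, rfl⟩ := hx
    rw [Equiv.Perm.viaEmbedding_apply, ι.injective.swap_apply]
  · rw [Equiv.Perm.viaEmbedding_apply_of_notMem _ _ _ hx,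
      Equiv.swap_apply_of_ne_of_ne (fun h => hx ⟨a, h.symm⟩) (fun h => hx ⟨b, h.symm⟩)]

theorem adj_mul_self {n : ℕ} (k : Fin (n - 1)) : adj k * adj k = 1 := Equiv.swap_mul_self _ _

theorem adj_comm {n : ℕ} {j k : Fin (n - 1)} (h : j.1 + 1 < k.1) : adj j * adj k = adj k * adj j :=
  (Equiv.Perm.disjoint_swap_swap (by simp [lo, hi]; omega)).commute

theorem adj_braid {n : ℕ} {j k : Fin (n - 1)} (h : j.1 + 1 = k.1) :
    adj j * adj k * adj j = adj k * adj j * adj k := by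
  have e : hi j = lo k := Fin.ext h
  have h1 : lo j ≠ hi k := by simp [lo, hi]; omega
  have h2 : lo j ≠ lo k := by simp [lo]; omega
  have h3 : lo k ≠ hi k := by simp [lo, hi]
  unfold adj
  rw [e]
  rw [Equiv.swap_comm (lo j), Equiv.swap_comm (lo k) (hi k),
    Equiv.swap_mul_swap_mul_swap h3.symm h1.symm, Equiv.swap_comm (hi k) (lo k),
    Equiv.swap_comm (lo k) (lo j), Equiv.swap_mul_swap_mul_swap h2 h1, Equiv.swap_comm]

/-- A family indexed by the adjacent transpositions and satisfying the Coxeter relations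
gives the same product on any two words for the same permutation. -/
theorem prod_eq_of_prod_adj_eq {M : Type*} [Monoid M] {n : ℕ} (g : Fin (n - 1) → M)
    (sq : ∀ k, g k * g k = 1)
    (braid : ∀ j k : Fin (n - 1), j.1 + 1 = k.1 → g j * g k * g j = g k * g j * g k)
    (comm : ∀ j k : Fin (n - 1), j.1 + 1 < k.1 → g j * g k = g k * g j)
    {w v : List (Fin (n - 1))} (h : (w.map adj).prod = (v.map adj).prod) :
    (w.map g).prod = (v.map g).prod := by
  -- Pairing each value with its transposition gives a monoid with a homomorphism to permutations,
  -- which `M` alone need not have.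
  let p : Fin (n - 1) → M × Equiv.Perm (Fin n) := fun k => (g k, adj k)
  let t : ℕ → M × Equiv.Perm (Fin n) := fun i => if h : i < n - 1 then p ⟨i, h⟩ else 1
  have ht : ∀ i (h : i < n - 1), t i = p ⟨i, h⟩ := fun i h => dif_pos h
  have H : CoxeterRelations t (n - 1) := by
    refine ⟨fun i hi => ?_, fun i hi => ?_, fun i j hij hj => ?_⟩
    · rw [ht i hi]; exact Prod.ext (sq _) (adj_mul_self _)
    · rw [ht i (by omega), ht (i + 1) hi]; exact Prod.ext (braid _ _ rfl) (adj_braid rfl)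
    · rw [ht i (by omega), ht j hj]; exact Prod.ext (comm _ _ hij) (adj_comm hij)
  let φ : M × Equiv.Perm (Fin n) →* Equiv.Perm ℕ :=
    (Equiv.Perm.viaEmbeddingHom Fin.valEmbedding).comp (MonoidHom.snd _ _)
  have hφ : ∀ i < n - 1, φ (t i) = Equiv.swap i (i + 1) := by
    intro i hi
    rw [ht i hi]
    exact viaEmbedding_swap _ _ _
  have mem : ∀ l : List (Fin (n - 1)), (l.map p).prod ∈ initialSubmonoid t (n - 1) := by
    intro l
    refine Submonoid.list_prod_mem _ fun x hx => ?_
    obtain ⟨k, -, rfl⟩ := List.mem_map.1 hx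
    rw [← ht k.1 k.2]
    exact mem_initialSubmonoid k.2
  have pfst : ∀ l : List (Fin (n - 1)), (l.map p).prod = ((l.map g).prod, (l.map adj).prod) := by
    intro l
    induction l with
    | nil => rfl
    | cons a l ih => simp [ih, p]
  have rev : ∀ l : List (Fin (n - 1)), (l.reverse.map p).prod * (l.map p).prod = 1 := by
    intro l
    induction l with
    | nil => simp
    | cons a l ih =>
      have e : p a * p a = 1 := Prod.ext (sq a) (adj_mul_self a)
      simp only [List.reverse_cons, List.map_append, List.map_cons, List.map_nil, List.prod_append,
        List.prod_cons, List.prod_nil, mul_one]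
      rw [mul_assoc, ← mul_assoc (p a), e, one_mul, ih]
  -- The generators are involutions, so the reversed word inverts `v`; triviality is read off from
  -- the permutation component.
  have key : (w.map p).prod * (v.reverse.map p).prod = 1 := by
    refine eq_one_of_perm_eq_one H φ hφ (n - 1) le_rfl (mul_mem (mem _) (mem _)) ?_
    have e : ((w.map p).prod * (v.reverse.map p).prod).2 = 1 := by
      have := congrArg Prod.snd (rev v)
      rw [Prod.snd_mul, pfst, pfst] at this ⊢
      simp only at this ⊢
      rw [h]
      exact mul_eq_one_comm.1 this
    change Equiv.Perm.viaEmbeddingHom Fin.valEmbedding _ = 1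
    rw [MonoidHom.coe_snd, e, map_one]
  have := congrArg (· * (v.map p).prod) key
  simp only [mul_assoc, rev v, mul_one, one_mul] at this
  have := congrArg Prod.fst this
  rwa [pfst, pfst] at this

/-- Fillings of a diagram, not necessarily standard. -/
abbrev Filling (μ : YoungDiagram) (n : ℕ) : Type := Fin n ≃ {c // c ∈ μ.cells}

/-- A filling is standard if its entries increase along rows and down columns. -/
def IsStandard {μ : YoungDiagram} {n : ℕ} (T : Filling μ n) : Prop :=
  ∀ a b, a.1 ≤ b.1 → T.symm a ≤ T.symm b

/-! ### Standard tableaux and the Coxeter relations for Young's matrices -/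

section Tableaux

variable {μ : YoungDiagram} {n : ℕ}

theorem lo_lt_hi (k : Fin (n - 1)) : lo k < hi k := by simp [lo, hi]

theorem IsStandard.le {T : Filling μ n} (h : IsStandard T) {i j : Fin n}
    (hij : (T i).1 ≤ (T j).1) : i ≤ j := by
  simpa using h _ _ hij

theorem mem_of_le {x y : ℕ × ℕ} (hy : y ∈ μ.cells) (h : x ≤ y) : x ∈ μ.cells :=
  μ.isLowerSet h hy

/-- The filling with the `k`-th and the next entry exchanged. -/
def exch (T : Filling μ n) (k : Fin (n - 1)) : Filling μ n := (adj k).trans T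

/-- The difference of contents of the boxes of two consecutive entries. -/
def gap (T : Filling μ n) (k : Fin (n - 1)) : ℤ :=
  content (T (hi k)).1 - content (T (lo k)).1

theorem exch_apply (T : Filling μ n) (k : Fin (n - 1)) (i : Fin n) :
    exch T k i = T (adj k i) := rfl

theorem adj_lo (k : Fin (n - 1)) : adj k (lo k) = hi k := Equiv.swap_apply_left _ _

theorem adj_hi (k : Fin (n - 1)) : adj k (hi k) = lo k := Equiv.swap_apply_right _ _

theorem adj_of_ne {k : Fin (n - 1)} {i : Fin n} (h1 : i ≠ lo k) (h2 : i ≠ hi k) : adj k i = i :=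
  Equiv.swap_apply_of_ne_of_ne h1 h2

theorem adj_symm (k : Fin (n - 1)) : (adj k).symm = adj k := Equiv.symm_swap _ _

theorem exch_ne (T : Filling μ n) (k : Fin (n - 1)) : exch T k ≠ T := by
  intro h
  have := DFunLike.congr_fun h (lo k)
  rw [exch_apply, adj_lo] at this
  exact (lo_lt_hi k).ne' (T.injective this)

theorem exch_exch (T : Filling μ n) (k : Fin (n - 1)) : exch (exch T k) k = T := by
  ext i : 1
  simp only [exch_apply]
  rw [← Equiv.Perm.mul_apply, adj_mul_self, Equiv.Perm.one_apply]

theorem exch_comm (T : Filling μ n) {j k : Fin (n - 1)} (h : j.1 + 1 < k.1) :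
    exch (exch T k) j = exch (exch T j) k := by
  ext i : 1
  simp only [exch_apply]
  rw [← Equiv.Perm.mul_apply, ← Equiv.Perm.mul_apply, adj_comm h]

theorem exch_braid (T : Filling μ n) {j k : Fin (n - 1)} (h : j.1 + 1 = k.1) :
    exch (exch (exch T k) j) k = exch (exch (exch T j) k) j := by
  ext i : 1
  simp only [exch_apply, ← Equiv.Perm.mul_apply, ← mul_assoc, adj_braid h]

theorem gap_exch_self (T : Filling μ n) (k : Fin (n - 1)) : gap (exch T k) k = -gap T k := by
  simp only [gap, exch_apply, adj_lo, adj_hi]; ring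

theorem gap_exch_right (T : Filling μ n) {j k : Fin (n - 1)} (h : j.1 + 1 = k.1) :
    gap (exch T k) j = gap T j + gap T k := by
  have e : hi j = lo k := Fin.ext h
  have h1 : adj k (lo j) = lo j :=
    adj_of_ne (by simp [lo]; omega) (by simp [lo, hi]; omega)
  simp only [gap, exch_apply, e, h1, adj_lo]; ring

theorem gap_exch_left (T : Filling μ n) {j k : Fin (n - 1)} (h : j.1 + 1 = k.1) :
    gap (exch T j) k = gap T j + gap T k := by
  have e : lo k = hi j := Fin.ext h.symm
  have h1 : adj j (hi k) = hi k :=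
    adj_of_ne (by simp [lo, hi]; omega) (by simp [hi]; omega)
  simp only [gap, exch_apply, e, h1, adj_hi]; ring

theorem gap_exch_of_far (T : Filling μ n) {j k : Fin (n - 1)}
    (h : j.1 + 1 < k.1 ∨ k.1 + 1 < j.1) : gap (exch T j) k = gap T k := by
  have h1 : adj j (lo k) = lo k := adj_of_ne (by simp [lo]; omega) (by simp [lo, hi]; omega)
  have h2 : adj j (hi k) = hi k := adj_of_ne (by simp [lo, hi]; omega) (by simp [hi]; omega)
  simp only [gap, exch_apply, h1, h2]

/-- Entries of a standard tableau that differ by at most two lie on different diagonals. -/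
theorem IsStandard.content_ne {T : Filling μ n} (h : IsStandard T) {i j : Fin n} (hij : i < j)
    (hj : j.1 ≤ i.1 + 2) : content (T j).1 ≠ content (T i).1 := by
  intro e
  rcases hx : (T i).1 with ⟨a, b⟩
  rcases hy : (T j).1 with ⟨a', b'⟩
  rw [hx, hy] at e
  simp only [content] at e
  have hyc := (T j).2
  rw [hy] at hyc
  have hlt : a < a' := by
    by_contra hle
    have : (T j).1 ≤ (T i).1 := by
      rw [hx, hy]; exact Prod.mk_le_mk.2 ⟨by omega, by omega⟩
    exact absurd (h.le this) (not_le.2 hij)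
  -- Any box strictly between the two holds an entry strictly between `i` and `j`. The boxes (a + 1,
  -- b) and (a, b + 1) would need two such entries, but there is room for at most one.
  have key : ∀ z : ℕ × ℕ, (a, b) ≤ z → z ≤ (a', b') → z ≠ (a, b) → z ≠ (a', b') →
      ∃ m : Fin n, i < m ∧ m < j ∧ (T m).1 = z := by
    intro z h1 h2 h3 h4
    have hz : (T (T.symm ⟨z, mem_of_le hyc h2⟩)).1 = z := by simp
    refine ⟨T.symm ⟨z, mem_of_le hyc h2⟩, lt_of_le_of_ne (h.le ?_) ?_,
      lt_of_le_of_ne (h.le ?_) ?_, hz⟩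
    · rw [hz, hx]; exact h1
    · rintro e'; rw [← e', hx] at hz; exact h3 hz.symm
    · rw [hz, hy]; exact h2
    · rintro e'; rw [e', hy] at hz; exact h4 hz.symm
  obtain ⟨m, hm1, hm2, hm⟩ := key (a + 1, b) (Prod.mk_le_mk.2 (by omega))
    (Prod.mk_le_mk.2 (by omega)) (by simp) (by simp; omega)
  obtain ⟨m', hm1', hm2', hm'⟩ := key (a, b + 1) (Prod.mk_le_mk.2 (by omega))
    (Prod.mk_le_mk.2 (by omega)) (by simp) (by simp; omega)
  have : m = m' := Fin.ext (by simp only [Fin.lt_def] at *; omega)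
  rw [this, hm'] at hm
  simp at hm

theorem IsStandard.gap_ne_zero {T : Filling μ n} (h : IsStandard T) (k : Fin (n - 1)) :
    gap T k ≠ 0 :=
  sub_ne_zero.2 (h.content_ne (lo_lt_hi k) (by simp [lo, hi]))

theorem IsStandard.gap_add_gap_ne_zero {T : Filling μ n} (h : IsStandard T) {j k : Fin (n - 1)}
    (hjk : j.1 + 1 = k.1) : gap T j + gap T k ≠ 0 := by
  have e : hi j = lo k := Fin.ext hjk
  have : content (T (hi k)).1 ≠ content (T (lo j)).1 :=
    h.content_ne (by simp [lo, hi, Fin.lt_def]; omega) (by simp [lo, hi]; omega)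
  simp only [gap, e]
  intro h'
  exact this (by linarith)

/-- The exchange of two consecutive entries of a standard tableau is standard unless their
boxes are comparable. -/
theorem IsStandard.exch_of_not_le {T : Filling μ n} (h : IsStandard T) {k : Fin (n - 1)}
    (hk : ¬ (T (lo k)).1 ≤ (T (hi k)).1) : IsStandard (exch T k) := by
  intro a b hab
  have hl := h a b hab
  change (adj k).symm (T.symm a) ≤ (adj k).symm (T.symm b)
  rw [adj_symm]
  by_cases hs : T.symm a = lo k ∧ T.symm b = hi k
  · refine absurd ?_ hk
    rw [← hs.1, ← hs.2]; simpa using hab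
  · generalize T.symm a = i at *
    generalize T.symm b = j at *
    unfold adj
    rw [Equiv.swap_apply_def, Equiv.swap_apply_def]
    simp only [lo, hi, Fin.ext_iff, Fin.le_def] at *
    split_ifs <;> simp <;> omega

/-- If the exchange is forbidden, the two boxes are comparable; no entry lies between consecutive
ones, so no box does either, and the boxes are neighbours in a row or column. -/
theorem IsStandard.gap_sq_eq_one {T : Filling μ n} (h : IsStandard T) {k : Fin (n - 1)}
    (hk : ¬ IsStandard (exch T k)) : gap T k ^ 2 = 1 := by
  have hle : (T (lo k)).1 ≤ (T (hi k)).1 := by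
    by_contra h'
    exact hk (h.exch_of_not_le h')
  have hne : (T (lo k)).1 ≠ (T (hi k)).1 := fun e =>
    (lo_lt_hi k).ne (T.injective (Subtype.ext e))
  have key : ∀ z : ℕ × ℕ, (T (lo k)).1 ≤ z → z ≤ (T (hi k)).1 → z ≠ (T (lo k)).1 →
      z = (T (hi k)).1 := by
    intro z h1 h2 h3
    have hzm := mem_of_le (T (hi k)).2 h2
    have hz : (T (T.symm ⟨z, hzm⟩)).1 = z := by simp
    have h4 : lo k ≤ T.symm ⟨z, hzm⟩ := h.le (by rw [hz]; exact h1)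
    have h5 : T.symm ⟨z, hzm⟩ ≤ hi k := h.le (by rw [hz]; exact h2)
    have h6 : lo k ≠ T.symm ⟨z, hzm⟩ := by
      rintro e; rw [← e] at hz; exact h3 hz.symm
    have : T.symm ⟨z, hzm⟩ = hi k := by
      simp only [lo, hi, Fin.le_def, Fin.ext_iff, ne_eq] at *; omega
    rw [← hz, this]
  unfold gap
  rcases hx : (T (lo k)).1 with ⟨a, b⟩
  rcases hy : (T (hi k)).1 with ⟨a', b'⟩
  rw [hx, hy] at key hle hne
  obtain ⟨h1, h2⟩ := Prod.mk_le_mk.1 hle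
  rcases h1.lt_or_eq with h3 | h3
  · have := key (a + 1, b) (Prod.mk_le_mk.2 (by omega)) (Prod.mk_le_mk.2 (by omega)) (by simp)
    simp only [Prod.mk.injEq] at this
    obtain ⟨rfl, rfl⟩ := this
    simp [content]
  · have h4 : b < b' := lt_of_le_of_ne h2 (by rintro rfl; exact hne (by rw [h3]))
    have := key (a, b + 1) (Prod.mk_le_mk.2 (by omega)) (Prod.mk_le_mk.2 (by omega)) (by simp)
    simp only [Prod.mk.injEq] at this
    obtain ⟨rfl, rfl⟩ := this
    simp [content]

/-- If both fillings are standard the boxes are incomparable, so row and column indices differ in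
opposite directions and the contents by at least 2. -/
theorem IsStandard.gap_sq_ne_one {T : Filling μ n} (h : IsStandard T) {k : Fin (n - 1)}
    (hk : IsStandard (exch T k)) : 1 < gap T k ^ 2 := by
  have h1 : ¬ (T (hi k)).1 ≤ (T (lo k)).1 := fun e => absurd (h.le e) (not_le.2 (lo_lt_hi k))
  have h2 : ¬ (T (lo k)).1 ≤ (T (hi k)).1 := by
    intro e
    refine absurd (hk.le (i := hi k) (j := lo k) ?_) (not_le.2 (lo_lt_hi k))
    rwa [exch_apply, exch_apply, adj_lo, adj_hi]
  unfold gap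
  rcases hx : (T (lo k)).1 with ⟨a, b⟩
  rcases hy : (T (hi k)).1 with ⟨a', b'⟩
  rw [hx, hy, Prod.mk_le_mk] at h1 h2
  rw [one_lt_sq_iff_one_lt_abs, lt_abs]
  simp only [content]
  omega

/-- The filling underlying a standard tableau. -/
def SYT.filling (T : SYT μ n) : Filling μ n := T.1

theorem SYT.isStandard (T : SYT μ n) : IsStandard T.filling := T.2

/-- The standard tableau given by a standard filling. -/
def SYT.ofFilling (T : Filling μ n) (h : IsStandard T) : SYT μ n := ⟨T, h⟩

theorem SYT.filling_ofFilling (T : Filling μ n) (h : IsStandard T) :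
    (SYT.ofFilling T h).filling = T := rfl

theorem SYT.filling_injective : Function.Injective (SYT.filling : SYT μ n → Filling μ n) :=
  Subtype.val_injective

theorem genMatrix_apply (k : Fin (n - 1)) (T S : SYT μ n) :
    genMatrix μ k T S = if T = S then 1 / (gap T.filling k : ℝ)
      else if exch T.filling k = S.filling then
        Real.sqrt (1 - 1 / (gap T.filling k : ℝ) ^ 2) else 0 := rfl

/-- Young's formula for an adjacent transposition, acting on functions of all fillings. -/
noncomputable def youngOp (k : Fin (n - 1)) (F : Filling μ n → ℝ) (T : Filling μ n) : ℝ :=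
  1 / (gap T k : ℝ) * F T + Real.sqrt (1 - 1 / (gap T k : ℝ) ^ 2) * F (exch T k)

/-- When the exchanged filling is not standard, the gap is ±1 and the square root vanishes. So
Young's formula may be used on all fillings, and the relations below need no case distinction on
standardness. -/
theorem genMatrix_mulVec (k : Fin (n - 1)) (F : Filling μ n → ℝ) :
    (genMatrix μ k).mulVec (fun S => F S.filling) = fun T => youngOp k F T.filling := by
  ext T
  have entry : ∀ S : SYT μ n, genMatrix μ k T S * F S.filling =
      (if T = S then 1 / (gap T.filling k : ℝ) * F S.filling else 0) +
      (if exch T.filling k = S.filling then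
        Real.sqrt (1 - 1 / (gap T.filling k : ℝ) ^ 2) * F S.filling else 0) := by
    intro S
    rw [genMatrix_apply]
    by_cases h : T = S
    · subst h; simp [exch_ne]
    · simp only [if_neg h, zero_add]; split_ifs <;> simp
  simp only [Matrix.mulVec, dotProduct, entry, Finset.sum_add_distrib, youngOp]
  congr 1
  · simp
  · by_cases hs : IsStandard (exch T.filling k)
    · rw [Finset.sum_eq_single (SYT.ofFilling _ hs)]
      · simp [SYT.filling_ofFilling]
      · intro S _ hS
        exact if_neg fun e => hS (SYT.filling_injective e.symm)
      · simp
    · have e : (gap T.filling k : ℝ) ^ 2 = 1 := by exact_mod_cast T.isStandard.gap_sq_eq_one hs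
      simp [e]

theorem matrix_ext_of_fillings {α : Type*} {A B : Matrix α (SYT μ n) ℝ}
    (h : ∀ (F : Filling μ n → ℝ) (T : α),
      A.mulVec (fun S => F S.filling) T = B.mulVec (fun S => F S.filling) T) : A = B := by
  refine Matrix.ext_of_mulVec_single fun S => ?_
  ext T
  have e : (Pi.single S 1 : SYT μ n → ℝ) =
      fun U => (fun V : Filling μ n => if V = S.filling then (1 : ℝ) else 0) U.filling := by
    ext U
    simp only [Pi.single_apply, SYT.filling_injective.eq_iff]
  rw [e]
  exact h (fun V : Filling μ n => if V = S.filling then (1 : ℝ) else 0) T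

theorem sq_sqrt_one_sub {d : ℤ} (h : d ≠ 0) :
    Real.sqrt (1 - 1 / (d : ℝ) ^ 2) ^ 2 = 1 - (1 / (d : ℝ)) ^ 2 := by
  rw [Real.sq_sqrt, one_div_pow]
  have : (1 : ℝ) ≤ (d : ℝ) ^ 2 := by
    exact_mod_cast Int.add_one_le_iff.2 (by positivity : 0 < d ^ 2)
  rw [sub_nonneg, div_le_one (by linarith)]
  exact this

theorem genMatrix_mul_self (k : Fin (n - 1)) : genMatrix μ k * genMatrix μ k = 1 := by
  refine matrix_ext_of_fillings fun F T => ?_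
  rw [← Matrix.mulVec_mulVec, genMatrix_mulVec, genMatrix_mulVec, Matrix.one_mulVec]
  have h0 := sq_sqrt_one_sub (T.isStandard.gap_ne_zero k)
  simp only [youngOp, gap_exch_self, exch_exch, Int.cast_neg, neg_sq, div_neg]
  linear_combination F T.filling * h0

theorem genMatrix_comm {j k : Fin (n - 1)} (h : j.1 + 1 < k.1) :
    genMatrix μ j * genMatrix μ k = genMatrix μ k * genMatrix μ j := by
  refine matrix_ext_of_fillings fun F T => ?_
  simp only [← Matrix.mulVec_mulVec, genMatrix_mulVec]
  simp only [youngOp, exch_comm _ h,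
    gap_exch_of_far _ (Or.inl h), gap_exch_of_far _ (Or.inr h)]
  ring

theorem genMatrix_braid {j k : Fin (n - 1)} (h : j.1 + 1 = k.1) :
    genMatrix μ j * genMatrix μ k * genMatrix μ j =
      genMatrix μ k * genMatrix μ j * genMatrix μ k := by
  refine matrix_ext_of_fillings fun F T => ?_
  simp only [← Matrix.mulVec_mulVec, genMatrix_mulVec]
  simp only [youngOp, exch_braid _ h, exch_exch,
    gap_exch_self, gap_exch_left _ h, gap_exch_right _ h]
  have hx := T.isStandard.gap_ne_zero j
  have hy := T.isStandard.gap_ne_zero k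
  have hz := T.isStandard.gap_add_gap_ne_zero h
  have h1 := sq_sqrt_one_sub hx
  have h2 := sq_sqrt_one_sub hy
  -- The identity 1/(xy) = (1/x + 1/y)/(x + y) for the gaps x, y is the core of the braid relation;
  -- the gap x + y appears after one exchange.
  have h3 : 1 / (gap T.filling j : ℝ) * (1 / (gap T.filling k : ℝ)) =
      1 / ((gap T.filling j + gap T.filling k : ℤ) : ℝ) * (1 / (gap T.filling j : ℝ) + 1 / (gap T.filling k : ℝ)) := by
    have hx' : (gap T.filling j : ℝ) ≠ 0 := by exact_mod_cast hx
    have hy' : (gap T.filling k : ℝ) ≠ 0 := by exact_mod_cast hy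
    have hz' : (gap T.filling j : ℝ) + (gap T.filling k : ℝ) ≠ 0 := by exact_mod_cast hz
    push_cast
    field_simp
    ring
  have e1 : -gap T.filling j + (gap T.filling j + gap T.filling k) = gap T.filling k := by ring
  have e2 : gap T.filling j + gap T.filling k + -gap T.filling k = gap T.filling j := by ring
  simp only [e1, e2, Int.cast_neg, neg_sq, div_neg]
  generalize (gap T.filling j : ℝ) = x at *
  generalize (gap T.filling k : ℝ) = y at *
  generalize ((gap T.filling j + gap T.filling k : ℤ) : ℝ) = z at *
  generalize Real.sqrt (1 - 1 / x ^ 2) = P at *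
  generalize Real.sqrt (1 - 1 / y ^ 2) = Q at *
  generalize Real.sqrt (1 - 1 / z ^ 2) = R at *
  generalize 1 / x = p at *
  generalize 1 / y = q at *
  generalize 1 / z = r at *
  -- Discrepancies occur only at `T` and its two single exchanges; the terms with two or three
  -- exchanges agree identically.
  linear_combination (F T.filling * (p - q) + P * F (exch T.filling j) -
    Q * F (exch T.filling k)) * h3 + r * F T.filling * (h1 - h2)

end Tableaux

/-! ### Jucys–Murphy elements, Schur's lemma and orthogonality -/

section Schur

variable {μ ν : YoungDiagram} {n : ℕ}

theorem repMatrix_eq_prod {σ : Equiv.Perm (Fin n)} {w : List (Fin (n - 1))}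
    (hw : (w.map adj).prod = σ) : repMatrix μ σ = (w.map (genMatrix μ)).prod :=
  prod_eq_of_prod_adj_eq (genMatrix μ) genMatrix_mul_self (fun _ _ => genMatrix_braid)
    (fun _ _ => genMatrix_comm) ((exists_word σ).choose_spec.trans hw.symm)

theorem repMatrix_one : repMatrix μ (1 : Equiv.Perm (Fin n)) = 1 :=
  repMatrix_eq_prod (w := []) rfl

theorem repMatrix_adj (k : Fin (n - 1)) : repMatrix μ (adj k) = genMatrix μ k := by
  rw [repMatrix_eq_prod (w := [k]) (by simp)]; simp

theorem repMatrix_mul (σ τ : Equiv.Perm (Fin n)) :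
    repMatrix μ (σ * τ) = repMatrix μ σ * repMatrix μ τ := by
  obtain ⟨w, hw⟩ := exists_word σ
  obtain ⟨v, hv⟩ := exists_word τ
  rw [repMatrix_eq_prod hw, repMatrix_eq_prod hv,
    repMatrix_eq_prod (w := w ++ v) (by simp [hw, hv])]
  simp

theorem genMatrix_transpose (k : Fin (n - 1)) : (genMatrix μ k).transpose = genMatrix μ k := by
  ext T S
  rw [Matrix.transpose_apply, genMatrix_apply, genMatrix_apply]
  by_cases h : S = T
  · subst h; rfl
  · rw [if_neg h, if_neg (Ne.symm h)]
    by_cases h' : exch T.filling k = S.filling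
    · rw [if_pos h', ← h', exch_exch, if_pos rfl, gap_exch_self]
      simp
    · rw [if_neg h', if_neg]
      rintro e
      exact h' (by rw [← e, exch_exch])

/-- The generators are symmetric involutions, so every representing matrix is orthogonal. -/
theorem repMatrix_inv (σ : Equiv.Perm (Fin n)) :
    repMatrix μ σ⁻¹ = (repMatrix μ σ).transpose := by
  have h : repMatrix μ σ * (repMatrix μ σ).transpose = 1 := by
    obtain ⟨w, hw⟩ := exists_word σ
    rw [repMatrix_eq_prod hw]
    clear hw
    induction w with
    | nil => simp
    | cons a w ih =>
      simp only [List.map_cons, List.prod_cons, Matrix.transpose_mul, genMatrix_transpose]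
      rw [mul_assoc, ← mul_assoc _ _ (genMatrix μ a), ih, one_mul, genMatrix_mul_self]
  have h' : repMatrix μ σ⁻¹ * repMatrix μ σ = 1 := by
    rw [← repMatrix_mul, inv_mul_cancel, repMatrix_one]
  exact left_inv_eq_right_inv h' h

/-- The diagonal matrix of the contents of the box containing a given entry. -/
noncomputable def contentMatrix (μ : YoungDiagram) {n : ℕ} (i : Fin n) :
    Matrix (SYT μ n) (SYT μ n) ℝ :=
  Matrix.diagonal fun T => (content (T.filling i).1 : ℝ)

/-- The degenerate affine Hecke relation: the diagonal entry 1/d times the content difference d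
produces the identity, and off the diagonal an exchange swaps the two contents. -/
theorem genMatrix_mul_contentMatrix (k : Fin (n - 1)) :
    genMatrix μ k * contentMatrix μ (lo k) + 1 = contentMatrix μ (hi k) * genMatrix μ k := by
  ext T S
  rw [Matrix.add_apply, contentMatrix, contentMatrix, Matrix.mul_diagonal, Matrix.diagonal_mul,
    genMatrix_apply, Matrix.one_apply]
  by_cases h : T = S
  · subst h
    simp only [if_true]
    have h0 : (gap T.filling k : ℝ) ≠ 0 := by exact_mod_cast T.isStandard.gap_ne_zero k
    field_simp
    simp only [gap]
    push_cast
    ring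
  · simp only [if_neg h, add_zero]
    split_ifs with h'
    · rw [← h', exch_apply, adj_lo, mul_comm]
    · simp

/-- The Jucys–Murphy recursion. Starting from 0 it expresses the content matrices through the
generators by formulas that do not involve the shape, so intertwiners respect them. -/
theorem contentMatrix_hi (k : Fin (n - 1)) : contentMatrix μ (hi k) =
    genMatrix μ k * contentMatrix μ (lo k) * genMatrix μ k + genMatrix μ k := by
  have := congrArg (· * genMatrix μ k) (genMatrix_mul_contentMatrix (μ := μ) k)
  simp only [mul_assoc, genMatrix_mul_self, mul_one, add_mul, one_mul] at this
  rw [← this, mul_assoc]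

theorem contentMatrix_zero (h : 0 < n) : contentMatrix μ (⟨0, h⟩ : Fin n) = 0 := by
  rw [contentMatrix, ← Matrix.diagonal_zero]
  congr 1
  ext T
  have hm : ((0, 0) : ℕ × ℕ) ∈ μ.cells :=
    mem_of_le (T.filling ⟨0, h⟩).2 (Prod.mk_le_mk.2 ⟨Nat.zero_le _, Nat.zero_le _⟩)
  have hle : T.filling.symm ⟨(0, 0), hm⟩ ≤ ⟨0, h⟩ :=
    T.isStandard.le (by simp [Prod.le_def])
  have : T.filling.symm ⟨(0, 0), hm⟩ = ⟨0, h⟩ := Fin.ext (Nat.le_zero.1 hle)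
  rw [← this]
  simp [content]

theorem intertwiner_contentMatrix {A : Matrix (SYT μ n) (SYT ν n) ℝ}
    (hA : ∀ k : Fin (n - 1), genMatrix μ k * A = A * genMatrix ν k) (i : Fin n) :
    contentMatrix μ i * A = A * contentMatrix ν i := by
  have step : ∀ k : Fin (n - 1), contentMatrix μ (lo k) * A = A * contentMatrix ν (lo k) →
      contentMatrix μ (hi k) * A = A * contentMatrix ν (hi k) := by
    intro k h
    calc contentMatrix μ (hi k) * A
        = genMatrix μ k * (contentMatrix μ (lo k) * (genMatrix μ k * A)) + genMatrix μ k * A := by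
          rw [contentMatrix_hi, Matrix.add_mul, Matrix.mul_assoc, Matrix.mul_assoc]
      _ = genMatrix μ k * A * (contentMatrix ν (lo k) * genMatrix ν k) + A * genMatrix ν k := by
          rw [hA k, ← Matrix.mul_assoc (contentMatrix μ (lo k)), h]
          simp only [Matrix.mul_assoc, ← hA k]
      _ = A * contentMatrix ν (hi k) := by
          rw [hA k, contentMatrix_hi, Matrix.mul_add]
          simp only [Matrix.mul_assoc]
  obtain ⟨i, hi'⟩ := i
  induction i with
  | zero => simp [contentMatrix_zero]
  | succ i ih => exact step ⟨i, by omega⟩ (ih (by omega))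

theorem intertwiner_apply_eq_zero {A : Matrix (SYT μ n) (SYT ν n) ℝ}
    (hA : ∀ k : Fin (n - 1), genMatrix μ k * A = A * genMatrix ν k) {T : SYT μ n} {S : SYT ν n} {i : Fin n}
    (h : content (T.filling i).1 ≠ content (S.filling i).1) : A T S = 0 := by
  have e := congrFun (congrFun (intertwiner_contentMatrix hA i) T) S
  rw [contentMatrix, contentMatrix, Matrix.mul_diagonal, Matrix.diagonal_mul] at e
  have h' : (content (T.filling i).1 : ℝ) - content (S.filling i).1 ≠ 0 :=
    sub_ne_zero.2 (by exact_mod_cast h)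
  exact (mul_eq_zero.1 (by linear_combination e :
    ((content (T.filling i).1 : ℝ) - content (S.filling i).1) * A T S = 0)).resolve_left h'

theorem le_or_le_of_content_eq {x y : ℕ × ℕ} (h : content x = content y) : x ≤ y ∨ y ≤ x := by
  simp only [content] at h
  simp only [Prod.le_def]
  omega

/-- A standard tableau is determined by the contents of its entries. -/
theorem box_eq_of_content_eq {T : Filling μ n} {S : Filling ν n} (hT : IsStandard T)
    (hS : IsStandard S) (h : ∀ i, content (T i).1 = content (S i).1) (i : Fin n) :
    (T i).1 = (S i).1 := by
  -- The box of `i` in `T` holds in `S` an entry at most `i`; a smaller entry would occupy that same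
  -- box in `T` too, by the induction hypothesis. The other comparison is the same with the tableaux
  -- interchanged.
  have aux : ∀ {μ ν : YoungDiagram} {T : Filling μ n} {S : Filling ν n}, IsStandard S →
      ∀ i, (∀ j < i, (T j).1 = (S j).1) → (T i).1 ≤ (S i).1 → (T i).1 = (S i).1 := by
    intro μ ν T S hS i ih hle
    have hm := mem_of_le (S i).2 hle
    have e : (S (S.symm ⟨(T i).1, hm⟩)).1 = (T i).1 := by simp
    have hji : S.symm ⟨(T i).1, hm⟩ ≤ i := hS.le (by rw [e]; exact hle)
    rcases hji.lt_or_eq with hlt | heq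
    · rw [← ih _ hlt] at e
      exact absurd (T.injective (Subtype.ext e)) hlt.ne
    · rw [heq] at e
      exact e.symm
  induction i using WellFoundedLT.induction with
  | ind i ih =>
    rcases le_or_le_of_content_eq (h i) with hle | hle
    · exact aux hS i ih hle
    · exact (aux hT i (fun j hj => (ih j hj).symm) hle).symm

theorem diagram_eq_of_box_eq {T : Filling μ n} {S : Filling ν n} (h : ∀ i, (T i).1 = (S i).1) :
    μ = ν := by
  ext x
  constructor
  · intro hx
    have := h (T.symm ⟨x, hx⟩)
    rw [Equiv.apply_symm_apply] at this
    rw [show x = _ from this]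
    exact Subtype.property _
  · intro hx
    have := h (S.symm ⟨x, hx⟩)
    rw [Equiv.apply_symm_apply] at this
    rw [← show _ = x from this]
    exact Subtype.property _

theorem intertwiner_eq_zero (hμν : μ ≠ ν) {A : Matrix (SYT μ n) (SYT ν n) ℝ}
    (hA : ∀ k : Fin (n - 1), genMatrix μ k * A = A * genMatrix ν k) : A = 0 := by
  ext T S
  by_contra h0
  refine hμν (diagram_eq_of_box_eq
    (box_eq_of_content_eq T.isStandard S.isStandard fun i => ?_))
  by_contra h
  exact h0 (intertwiner_apply_eq_zero hA h)

/-- A function on standard tableaux that is invariant under admissible exchanges of consecutive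
entries is constant. -/
theorem eq_of_exch_invariant {α : Type*} (f : SYT μ n → α)
    (hf : ∀ T k (h : IsStandard (exch T.filling k)), f (SYT.ofFilling _ h) = f T)
    (T S : SYT μ n) : f T = f S := by
  by_contra hTS
  -- `q U i` is the entry of `S` in the box where `U` has `i`. Among tableaux violating the claim,
  -- take one maximizing the sum of i * q U i; a descent of `q U` exists since otherwise U = S.
  let q : Filling μ n → Fin n → ℕ := fun T i => (S.filling.symm (T i)).1
  obtain ⟨U, hU, hmax⟩ := Set.exists_max_image {U | f U ≠ f S}
    (fun U : SYT μ n => ∑ i, i.1 * q U.filling i) (Set.toFinite _) ⟨T, hTS⟩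
  have hdes : ∃ k : Fin (n - 1), q U.filling (hi k) < q U.filling (lo k) := by
    by_contra hno
    push Not at hno
    cases n with
    | zero => exact hU (congrArg f (SYT.filling_injective (Equiv.ext fun i => i.elim0)))
    | succ m =>
      have hmono : Monotone fun i : Fin (m + 1) => S.filling.symm (U.filling i) :=
        Fin.monotone_iff_le_succ.2 fun i => Fin.le_def.2 (hno i)
      have hinj : Function.Injective fun i : Fin (m + 1) => S.filling.symm (U.filling i) :=
        S.filling.symm.injective.comp U.filling.injective
      have hid := Subsingleton.elim
        ((hmono.strictMono_of_injective hinj).orderIsoOfSurjective _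
          (Finite.surjective_of_injective hinj)) (OrderIso.refl _)
      refine hU (congrArg f (SYT.filling_injective (Equiv.ext fun i => ?_)))
      have : S.filling.symm (U.filling i) = i := DFunLike.congr_fun hid i
      rw [← this, Equiv.apply_symm_apply, this]
  obtain ⟨k, hk⟩ := hdes
  -- Comparable boxes would be ordered the same way by `S`, against the descent. The exchange is
  -- thus admissible, and it raises the sum by the size of the descent, contradicting maximality.
  have hstd : IsStandard (exch U.filling k) := by
    refine U.isStandard.exch_of_not_le fun hle => ?_
    have := S.isStandard _ _ hle
    exact absurd hk (not_lt.2 this)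
  have hlt := hmax (SYT.ofFilling _ hstd) (by rw [Set.mem_ofPred_eq, hf]; exact hU)
  rw [SYT.filling_ofFilling] at hlt
  have e1 : ∑ i, i.1 * q (exch U.filling k) i = ∑ i, (adj k i).1 * q U.filling i := by
    rw [← Equiv.sum_comp (adj k)]
    refine Finset.sum_congr rfl fun i _ => ?_
    simp only [q, exch_apply, ← Equiv.Perm.mul_apply, adj_mul_self, Equiv.Perm.one_apply]
  rw [e1] at hlt
  have split : ∀ g : Fin n → ℕ,
      ∑ i, g i = g (lo k) + (g (hi k) + ∑ i ∈ (Finset.univ.erase (lo k)).erase (hi k), g i) := by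
    intro g
    rw [Finset.add_sum_erase _ _ (Finset.mem_erase.2 ⟨(lo_lt_hi k).ne', Finset.mem_univ _⟩),
      Finset.add_sum_erase _ _ (Finset.mem_univ _)]
  rw [split, split fun i => i.1 * _] at hlt
  have e2 : ∑ i ∈ (Finset.univ.erase (lo k)).erase (hi k), (adj k i).1 * q U.filling i =
      ∑ i ∈ (Finset.univ.erase (lo k)).erase (hi k), i.1 * q U.filling i := by
    refine Finset.sum_congr rfl fun i hi' => ?_
    simp only [Finset.mem_erase, Finset.mem_univ, and_true] at hi'
    rw [adj_of_ne hi'.2 hi'.1]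
  rw [e2, adj_lo, adj_hi] at hlt
  have e3 : (hi k).1 = (lo k).1 + 1 := rfl
  rw [e3] at hlt
  nlinarith

/-- Contents separate tableaux, so `A` is diagonal. Off-diagonal entries of the generators at
admissible exchanges are nonzero and force equal diagonal entries; such exchanges connect all
tableaux. -/
theorem intertwiner_eq_scalar {A : Matrix (SYT μ n) (SYT μ n) ℝ}
    (hA : ∀ k : Fin (n - 1), genMatrix μ k * A = A * genMatrix μ k) :
    ∃ a : ℝ, A = a • (1 : Matrix (SYT μ n) (SYT μ n) ℝ) := by
  have hdiag : A = Matrix.diagonal fun T => A T T := by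
    ext T S
    rw [Matrix.diagonal_apply]
    split_ifs with h
    · rw [h]
    · by_contra h0
      refine h (SYT.filling_injective (Equiv.ext fun i => Subtype.ext
        (box_eq_of_content_eq T.isStandard S.isStandard (fun i => ?_) i)))
      by_contra h
      exact h0 (intertwiner_apply_eq_zero hA h)
  rcases isEmpty_or_nonempty (SYT μ n) with h | ⟨⟨S⟩⟩
  · exact ⟨0, Subsingleton.elim _ _⟩
  refine ⟨A S S, ?_⟩
  rw [hdiag, Matrix.smul_one_eq_diagonal]
  congr 1
  ext T
  rw [Matrix.diagonal_apply_eq]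
  refine eq_of_exch_invariant (fun T => A T T) (fun T k h => ?_) T S
  have e := congrFun (congrFun (hA k) T) (SYT.ofFilling _ h)
  rw [hdiag, Matrix.mul_diagonal, Matrix.diagonal_mul, mul_comm] at e
  refine mul_right_cancel₀ ?_ e
  have hd : (1 : ℝ) < (gap T.filling k : ℝ) ^ 2 := by
    exact_mod_cast T.isStandard.gap_sq_ne_one h
  rw [genMatrix_apply, if_neg, if_pos (SYT.filling_ofFilling _ h).symm]
  · refine (Real.sqrt_pos.2 ?_).ne'
    rw [sub_pos, div_lt_one (by linarith)]
    exact hd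
  · intro e
    exact exch_ne T.filling k (congrArg SYT.filling e).symm

/-- The average intertwiner obtained from a matrix. -/
noncomputable def averageMatrix (B : Matrix (SYT μ n) (SYT ν n) ℝ) :
    Matrix (SYT μ n) (SYT ν n) ℝ :=
  ∑ τ : Equiv.Perm (Fin n), repMatrix μ τ * B * repMatrix ν τ⁻¹

theorem averageMatrix_intertwines (B : Matrix (SYT μ n) (SYT ν n) ℝ) (k : Fin (n - 1)) :
    genMatrix μ k * averageMatrix B = averageMatrix B * genMatrix ν k := by
  unfold averageMatrix
  rw [Matrix.mul_sum, Matrix.sum_mul, ← Equiv.sum_comp (Equiv.mulLeft (adj k))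
    fun τ => repMatrix μ τ * B * repMatrix ν τ⁻¹ * genMatrix ν k]
  refine Finset.sum_congr rfl fun τ _ => ?_
  rw [Equiv.coe_mulLeft, mul_inv_rev, repMatrix_mul, repMatrix_mul, repMatrix_inv (adj k),
    repMatrix_adj, repMatrix_adj, genMatrix_transpose]
  simp only [Matrix.mul_assoc, genMatrix_mul_self, Matrix.mul_one]

/-- A product of diagonal entries at `T` and `S` is the (T, S) entry of the conjugated matrix unit;
passing from τ to its inverse in the second factor keeps the trace, by orthogonality of the
matrices. -/
theorem sum_trace_mul_trace (μ ν : YoungDiagram) (n : ℕ) :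
    ∑ τ : Equiv.Perm (Fin n), (repMatrix μ τ).trace * (repMatrix ν τ).trace =
      ∑ T : SYT μ n, ∑ S : SYT ν n, averageMatrix (Matrix.single T S 1) T S := by
  have h : ∀ τ : Equiv.Perm (Fin n), (repMatrix μ τ).trace * (repMatrix ν τ).trace =
      ∑ T : SYT μ n, ∑ S : SYT ν n,
        (repMatrix μ τ * (Matrix.single T S 1 : Matrix (SYT μ n) (SYT ν n) ℝ) *
          repMatrix ν τ⁻¹) T S := by
    intro τ
    rw [← Matrix.trace_transpose (repMatrix ν τ), ← repMatrix_inv, Matrix.trace, Matrix.trace,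
      Finset.sum_mul_sum]
    refine Finset.sum_congr rfl fun T _ => Finset.sum_congr rfl fun S _ => ?_
    simp [Matrix.mul_apply, Matrix.single_apply, ite_and]
  simp only [h, averageMatrix, Matrix.sum_apply]
  rw [Finset.sum_comm]
  exact Finset.sum_congr rfl fun T _ => Finset.sum_comm

theorem sum_trace_mul_trace_of_ne (h : μ ≠ ν) :
    ∑ τ : Equiv.Perm (Fin n), (repMatrix μ τ).trace * (repMatrix ν τ).trace = 0 := by
  rw [sum_trace_mul_trace]
  refine Finset.sum_eq_zero fun T _ => Finset.sum_eq_zero fun S _ => ?_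
  rw [intertwiner_eq_zero h (averageMatrix_intertwines _), Matrix.zero_apply]

/-- Each averaged matrix unit is scalar, and its trace, n! times that of the unit, identifies the
scalar. The tableau `T₀` rules out dimension 0. -/
theorem sum_trace_mul_trace_self (T₀ : SYT μ n) :
    ∑ τ : Equiv.Perm (Fin n), (repMatrix μ τ).trace * (repMatrix μ τ).trace = n.factorial := by
  rw [sum_trace_mul_trace]
  have hcard : (Fintype.card (SYT μ n) : ℝ) ≠ 0 := by
    have : Nonempty (SYT μ n) := ⟨T₀⟩
    exact_mod_cast Fintype.card_ne_zero
  have htr : ∀ B : Matrix (SYT μ n) (SYT μ n) ℝ,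
      (averageMatrix B).trace = n.factorial * B.trace := by
    intro B
    have e : ∀ τ : Equiv.Perm (Fin n),
        (repMatrix μ τ * B * repMatrix μ τ⁻¹).trace = B.trace := by
      intro τ
      rw [Matrix.trace_mul_comm, ← Matrix.mul_assoc, ← repMatrix_mul, inv_mul_cancel,
        repMatrix_one, Matrix.one_mul]
    simp [averageMatrix, Matrix.trace_sum, e, Fintype.card_perm]
  have hentry : ∀ T S : SYT μ n, averageMatrix (Matrix.single T S 1) T S =
      if T = S then (n.factorial : ℝ) / Fintype.card (SYT μ n) else 0 := by
    intro T S
    obtain ⟨a, ha⟩ := intertwiner_eq_scalar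
      (averageMatrix_intertwines (Matrix.single T S 1 : Matrix (SYT μ n) (SYT μ n) ℝ))
    have ht := htr (Matrix.single T S 1)
    rw [ha, Matrix.trace_smul, Matrix.trace_one] at ht
    rw [ha, Matrix.smul_apply, Matrix.one_apply]
    split_ifs with h
    · subst h
      rw [Matrix.trace_single_eq_same] at ht
      rw [eq_div_iff hcard]
      simpa using ht
    · simp
  simp only [hentry, Finset.sum_ite_eq, Finset.mem_univ, if_true, Finset.sum_const,
    Finset.card_univ, nsmul_eq_mul]
  field_simp

end Schur

/-! ### Restriction to the smaller symmetric group -/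

section Branching

variable {μ : YoungDiagram} {n r : ℕ}

/-- The diagram of the boxes of a standard tableau that contain its first `r` entries. -/
def truncation (T : SYT μ n) (r : ℕ) : YoungDiagram where
  cells := (Finset.univ.filter fun i : Fin n => i.1 < r).image fun i => (T.filling i).1
  isLowerSet := by
    intro x y hyx hx
    simp only [Finset.coe_image, Set.mem_image, Finset.coe_filter, Finset.mem_univ, true_and,
      Set.mem_ofPred_eq] at hx ⊢
    obtain ⟨i, hi, rfl⟩ := hx
    have hy := mem_of_le (T.filling i).2 hyx
    refine ⟨T.filling.symm ⟨y, hy⟩, lt_of_le_of_lt ?_ hi, by simp⟩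
    exact T.isStandard.le (by simpa using hyx)

theorem mem_truncation {T : SYT μ n} {x : ℕ × ℕ} :
    x ∈ (truncation T r).cells ↔ ∃ i : Fin n, i.1 < r ∧ (T.filling i).1 = x := by
  simp [truncation]

theorem card_truncation (T : SYT μ n) (h : r ≤ n) : (truncation T r).card = r := by
  change ((Finset.univ.filter fun i : Fin n => i.1 < r).image fun i => (T.filling i).1).card = r
  have hinj : Function.Injective fun i => (T.filling i).1 :=
    Subtype.val_injective.comp T.filling.injective
  rw [Finset.card_image_of_injective _ hinj, Fin.card_filter_val_lt, min_eq_right h]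

/-- Two standard tableaux with the same boxes for the entries after the first `r`. -/
def SameTail (r : ℕ) (S T : SYT μ n) : Prop := ∀ i : Fin n, r ≤ i.1 → S.filling i = T.filling i

theorem SameTail.mem_truncation {S T : SYT μ n} (h : SameTail r S T) {i : Fin n} (hi : i.1 < r) :
    (S.filling i).1 ∈ (truncation T r).cells := by
  refine Seminormal.mem_truncation.2 ⟨T.filling.symm (S.filling i), ?_, by simp⟩
  by_contra hj
  have := h _ (not_lt.1 hj)
  rw [Equiv.apply_symm_apply, S.filling.injective.eq_iff] at this
  rw [this] at hj
  exact hj hi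

/-- The first `r` entries of a tableau, as a filling of the truncation of a tableau with the
same tail. -/
noncomputable def SameTail.restrict {S T : SYT μ n} (h : SameTail r S T) (hr : r ≤ n) :
    Filling (truncation T r) r :=
  Equiv.ofBijective (fun i => ⟨(S.filling (Fin.castLE hr i)).1, h.mem_truncation i.2⟩) <| by
    rw [Fintype.bijective_iff_injective_and_card]
    refine ⟨fun i j hij => ?_, ?_⟩
    · have e : (S.filling (Fin.castLE hr i)).1 = (S.filling (Fin.castLE hr j)).1 :=
        Subtype.mk.inj hij
      exact Fin.castLE_injective hr (S.filling.injective (Subtype.ext e))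
    · rw [Fintype.card_fin, Fintype.card_coe]
      exact (card_truncation T hr).symm

theorem SameTail.restrict_apply {S T : SYT μ n} (h : SameTail r S T) (hr : r ≤ n) (i : Fin r) :
    (h.restrict hr i).1 = (S.filling (Fin.castLE hr i)).1 := rfl

theorem sameTail_refl (T : SYT μ n) : SameTail r T T := fun _ _ => rfl

/-- Replace the first `r` entries of a standard tableau by a filling of their boxes. -/
noncomputable def glue (hr : r ≤ n) (T : SYT μ n) (U : Filling (truncation T r) r) :
    Filling μ n :=
  -- Permuting the entries of `T` by an included element of S_r makes bijectivity automatic and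
  -- reduces compatibility with exchanges to `incl` being a homomorphism.
  (incl hr (U.trans ((sameTail_refl T).restrict hr).symm)).trans T.filling

theorem incl_apply_castLE (hr : r ≤ n) (π : Equiv.Perm (Fin r)) (i : Fin r) :
    incl hr π (Fin.castLE hr i) = Fin.castLE hr (π i) :=
  Equiv.Perm.viaEmbedding_apply π (Fin.castLEEmb hr) i

theorem incl_apply_of_le (hr : r ≤ n) (π : Equiv.Perm (Fin r)) {i : Fin n} (hi : r ≤ i.1) :
    incl hr π i = i := by
  refine Equiv.Perm.viaEmbedding_apply_of_notMem π (Fin.castLEEmb hr) i ?_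
  rintro ⟨j, rfl⟩
  exact absurd j.2 (not_lt.2 hi)

/-- The index of an adjacent transposition after adding fixed points. -/
def castIndex (hr : r ≤ n) (k : Fin (r - 1)) : Fin (n - 1) := Fin.castLE (by omega) k

theorem incl_adj (hr : r ≤ n) (k : Fin (r - 1)) : incl hr (adj k) = adj (castIndex hr k) :=
  viaEmbedding_swap (Fin.castLEEmb hr) (lo k) (hi k)

theorem glue_castLE (hr : r ≤ n) (T : SYT μ n) (U : Filling (truncation T r) r) (i : Fin r) :
    (glue hr T U (Fin.castLE hr i)).1 = (U i).1 := by
  rw [glue, Equiv.trans_apply, incl_apply_castLE,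
    ← (sameTail_refl T).restrict_apply hr, Equiv.trans_apply, Equiv.apply_symm_apply]

theorem glue_of_le (hr : r ≤ n) (T : SYT μ n) (U : Filling (truncation T r) r) {i : Fin n}
    (hi : r ≤ i.1) : glue hr T U i = T.filling i := by
  rw [glue, Equiv.trans_apply, incl_apply_of_le hr _ hi]

theorem glue_exch (hr : r ≤ n) (T : SYT μ n) (U : Filling (truncation T r) r) (k : Fin (r - 1)) :
    glue hr T (exch U k) = exch (glue hr T U) (castIndex hr k) := by
  have e : (exch U k).trans ((sameTail_refl T).restrict hr).symm =
      (U.trans ((sameTail_refl T).restrict hr).symm : Equiv.Perm (Fin r)) * adj k := rfl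
  rw [glue, e, map_mul, incl_adj]
  rfl

theorem gap_glue (hr : r ≤ n) (T : SYT μ n) (U : Filling (truncation T r) r) (k : Fin (r - 1)) :
    gap (glue hr T U) (castIndex hr k) = gap U k := by
  have h1 := glue_castLE hr T U (lo k)
  have h2 := glue_castLE hr T U (hi k)
  unfold gap
  rw [← h1, ← h2]
  rfl

theorem isStandard_of_le {T : Filling μ n} (h : ∀ i j, (T i).1 ≤ (T j).1 → i ≤ j) :
    IsStandard T :=
  fun a b hab => h _ _ (by simpa using hab)

theorem IsStandard.glue (hr : r ≤ n) (T : SYT μ n) {U : Filling (truncation T r) r}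
    (hU : IsStandard U) : IsStandard (glue hr T U) := by
  refine isStandard_of_le fun i j hij => ?_
  by_cases hj : r ≤ j.1
  · by_cases hi : r ≤ i.1
    · rw [glue_of_le hr T U hi, glue_of_le hr T U hj] at hij
      exact T.isStandard.le hij
    · exact Fin.le_def.2 (by omega)
  · obtain ⟨j, rfl⟩ : ∃ j', j = Fin.castLE hr j' := ⟨⟨j, by omega⟩, rfl⟩
    rw [glue_castLE] at hij
    by_cases hi : r ≤ i.1
    · rw [glue_of_le hr T U hi] at hij
      -- A late entry cannot sit weakly before a box of the truncation, because in `T` that box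
      -- holds one of the first `r` entries.
      obtain ⟨l, hl, e⟩ := mem_truncation.1 (U j).2
      rw [← e] at hij
      have := Fin.le_def.1 (T.isStandard.le hij)
      omega
    · obtain ⟨i, rfl⟩ : ∃ i', i = Fin.castLE hr i' := ⟨⟨i, by omega⟩, rfl⟩
      rw [glue_castLE] at hij
      exact hU.le hij

/-- Replace the first `r` entries of a standard tableau by a standard tableau. -/
noncomputable def graft (hr : r ≤ n) (T : SYT μ n) (U : SYT (truncation T r) r) : SYT μ n :=
  SYT.ofFilling (glue hr T U.filling) (U.isStandard.glue hr T)

theorem graft_filling (hr : r ≤ n) (T : SYT μ n) (U : SYT (truncation T r) r) :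
    (graft hr T U).filling = glue hr T U.filling := rfl

theorem graft_injective (hr : r ≤ n) (T : SYT μ n) : Function.Injective (graft hr T) := by
  intro U V h
  refine SYT.filling_injective (Equiv.ext fun i => Subtype.ext ?_)
  rw [← glue_castLE hr T, ← glue_castLE hr T, ← graft_filling, ← graft_filling, h]

theorem sameTail_graft (hr : r ≤ n) (T : SYT μ n) (U : SYT (truncation T r) r) :
    SameTail r (graft hr T U) T :=
  fun _ hi => glue_of_le hr T _ hi

theorem SameTail.exists_graft (hr : r ≤ n) {S T : SYT μ n} (h : SameTail r S T) :
    ∃ U, graft hr T U = S := by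
  have hU : IsStandard (h.restrict hr) := isStandard_of_le fun i j hij => by
    rw [h.restrict_apply, h.restrict_apply] at hij
    exact S.isStandard.le hij
  refine ⟨SYT.ofFilling _ hU, SYT.filling_injective (Equiv.ext fun i => ?_)⟩
  rw [graft_filling, SYT.filling_ofFilling]
  by_cases hi : r ≤ i.1
  · rw [glue_of_le hr T _ hi, h i hi]
  · obtain ⟨i, rfl⟩ : ∃ i', i = Fin.castLE hr i' := ⟨⟨i, by omega⟩, rfl⟩
    exact Subtype.ext (by rw [glue_castLE, h.restrict_apply])

/-- The matrix of the embedding of tableaux given by `graft`. -/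
noncomputable def graftMatrix (hr : r ≤ n) (T : SYT μ n) :
    Matrix (SYT (truncation T r) r) (SYT μ n) ℝ :=
  Matrix.of fun U S => if graft hr T U = S then 1 else 0

theorem graftMatrix_mulVec (hr : r ≤ n) (T : SYT μ n) (f : SYT μ n → ℝ) :
    (graftMatrix hr T).mulVec f = fun U => f (graft hr T U) := by
  ext U
  simp [graftMatrix, Matrix.mulVec, dotProduct]

theorem youngOp_glue (hr : r ≤ n) (T : SYT μ n) (k : Fin (r - 1)) (F : Filling μ n → ℝ)
    (U : Filling (truncation T r) r) :
    youngOp (castIndex hr k) F (glue hr T U) = youngOp k (fun V => F (glue hr T V)) U := by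
  simp only [youngOp, gap_glue, glue_exch]

/-- Exchanging two of the first `r` entries keeps the tail and the gaps, so Young's formula on a
block is that of the truncated shape. -/
theorem graftMatrix_mul_genMatrix (hr : r ≤ n) (T : SYT μ n) (k : Fin (r - 1)) :
    graftMatrix hr T * genMatrix μ (castIndex hr k) =
      genMatrix (truncation T r) k * graftMatrix hr T := by
  refine matrix_ext_of_fillings fun F U => ?_
  rw [← Matrix.mulVec_mulVec, ← Matrix.mulVec_mulVec, genMatrix_mulVec, graftMatrix_mulVec,
    graftMatrix_mulVec]
  simp only [graft_filling, youngOp_glue]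
  exact (congrFun (genMatrix_mulVec k fun V => F (glue hr T V)) U).symm

theorem graftMatrix_mul_repMatrix (hr : r ≤ n) (T : SYT μ n) (τ : Equiv.Perm (Fin r)) :
    graftMatrix hr T * repMatrix μ (incl hr τ) =
      repMatrix (truncation T r) τ * graftMatrix hr T := by
  obtain ⟨w, rfl⟩ := exists_word τ
  induction w with
  | nil => simp [repMatrix_one]
  | cons k w ih =>
    rw [List.map_cons, List.prod_cons, map_mul, repMatrix_mul, repMatrix_mul, incl_adj,
      repMatrix_adj, repMatrix_adj, ← Matrix.mul_assoc, graftMatrix_mul_genMatrix,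
      Matrix.mul_assoc, ih, Matrix.mul_assoc]

/-- Apply the intertwining relation to the all-ones vector, which restricts to the all-ones vector
on each block: this is why row sums, and not only traces, restrict well. -/
theorem sum_repMatrix_graft (hr : r ≤ n) (T : SYT μ n) (τ : Equiv.Perm (Fin r))
    (U : SYT (truncation T r) r) :
    ∑ S, repMatrix μ (incl hr τ) (graft hr T U) S = ∑ V, repMatrix (truncation T r) τ U V := by
  have h := congrFun (congrArg (fun A => A.mulVec fun _ => 1) (graftMatrix_mul_repMatrix hr T τ)) U
  simp only [← Matrix.mulVec_mulVec, graftMatrix_mulVec] at h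
  simpa [Matrix.mulVec, dotProduct] using h

theorem repMatrix_graft_graft (hr : r ≤ n) (T : SYT μ n) (τ : Equiv.Perm (Fin r))
    (U : SYT (truncation T r) r) :
    repMatrix μ (incl hr τ) (graft hr T U) (graft hr T U) = repMatrix (truncation T r) τ U U := by
  have h := congrFun (congrFun (graftMatrix_mul_repMatrix hr T τ) U) (graft hr T U)
  simpa [graftMatrix, Matrix.mul_apply, (graft_injective hr T).eq_iff] using h

/-- The relation of having the same entries after the first `r` ones. -/
def tailSetoid (μ : YoungDiagram) (n r : ℕ) : Setoid (SYT μ n) where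
  r := SameTail r
  iseqv := ⟨sameTail_refl, fun h i hi => (h i hi).symm,
    fun h h' i hi => (h i hi).trans (h' i hi)⟩

noncomputable instance fintype_tailQuotient (μ : YoungDiagram) (n r : ℕ) :
    Fintype (Quotient (tailSetoid μ n r)) :=
  Fintype.ofFinite _

/-- Grafting onto a representative is a bijection from the standard tableaux of the truncated shape
to the tableaux with the given tail. -/
theorem sum_eq_sum_graft (hr : r ≤ n) (g : SYT μ n → ℝ) :
    ∑ T, g T = ∑ q : Quotient (tailSetoid μ n r), ∑ U, g (graft hr q.out U) := by
  classical
  rw [← Finset.sum_fiberwise Finset.univ fun T => (Quotient.mk (tailSetoid μ n r) T)]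
  refine Finset.sum_congr rfl fun q _ => (Finset.sum_bij (fun U _ => graft hr q.out U) ?_ ?_ ?_
    fun _ _ => rfl).symm
  · intro U _
    refine Finset.mem_filter.2 ⟨Finset.mem_univ _, Eq.trans ?_ (Quotient.out_eq q)⟩
    exact Quotient.sound (sameTail_graft hr q.out U)
  · exact fun U _ V _ h => graft_injective hr _ h
  · intro S hS
    have hq := (Finset.mem_filter.1 hS).2
    have : SameTail r S q.out := Quotient.exact (hq.trans (Quotient.out_eq q).symm)
    obtain ⟨U, hU⟩ := this.exists_graft hr
    exact ⟨U, Finset.mem_univ _, hU⟩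

theorem trace_repMatrix_incl (hr : r ≤ n) (τ : Equiv.Perm (Fin r)) :
    (repMatrix μ (incl hr τ)).trace =
      ∑ q : Quotient (tailSetoid μ n r), (repMatrix (truncation q.out r) τ).trace := by
  simp only [Matrix.trace, Matrix.diag_apply]
  rw [sum_eq_sum_graft hr]
  simp only [repMatrix_graft_graft]

theorem sum_repMatrix_incl (hr : r ≤ n) (τ : Equiv.Perm (Fin r)) :
    ∑ T, ∑ S, repMatrix μ (incl hr τ) T S =
      ∑ q : Quotient (tailSetoid μ n r), ∑ U, ∑ V, repMatrix (truncation q.out r) τ U V := by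
  rw [sum_eq_sum_graft hr]
  simp only [sum_repMatrix_graft]

theorem plancherel_weight (ν : YoungDiagram) (hν : ν.card = r) (σ τ : Equiv.Perm (Fin r)) :
    (dim ν : ℝ) ^ 2 / (r.factorial : ℝ) * (normChar ν τ * totalSum ν σ) =
      (repMatrix ν τ).trace * (∑ U, ∑ V, repMatrix ν σ U V) / r.factorial := by
  subst hν
  unfold normChar totalSum
  -- The squared dimension cancels both denominators; in dimension 0 the traces and sums are empty,
  -- so both sides vanish.
  by_cases h : dim ν = 0
  · have : IsEmpty (SYT ν ν.card) := Fintype.card_eq_zero_iff.1 h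
    simp [h]
  · field_simp

theorem sum_trace_mul_sum (σ : Equiv.Perm (Fin r)) {ν : YoungDiagram} (T₀ : SYT ν r)
    (hν : ν.card = r) :
    ∑ κ : DiagramOfSize r, ∑ τ : Equiv.Perm (Fin r), (repMatrix κ.1 τ).trace *
      (∑ U, ∑ V, repMatrix κ.1 σ U V) / r.factorial * (repMatrix ν τ).trace =
      ∑ U, ∑ V, repMatrix ν σ U V := by
  have e : ∀ κ : DiagramOfSize r, ∑ τ : Equiv.Perm (Fin r), (repMatrix κ.1 τ).trace *
      (∑ U, ∑ V, repMatrix κ.1 σ U V) / r.factorial * (repMatrix ν τ).trace =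
      (∑ U, ∑ V, repMatrix κ.1 σ U V) / r.factorial *
        ∑ τ : Equiv.Perm (Fin r), (repMatrix κ.1 τ).trace * (repMatrix ν τ).trace := by
    intro κ
    rw [Finset.mul_sum]
    exact Finset.sum_congr rfl fun τ _ => by ring
  rw [Finset.sum_congr rfl fun κ _ => e κ, Finset.sum_eq_single (⟨ν, hν⟩ : DiagramOfSize r)]
  · rw [sum_trace_mul_trace_self T₀,
      div_mul_cancel₀ _ (by exact_mod_cast r.factorial_ne_zero)]
  · intro κ _ hκ
    rw [sum_trace_mul_trace_of_ne fun h => hκ (Subtype.ext h), mul_zero]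
  · simp

end Branching

end Seminormal

theorem mainTheorem6 {r n : ℕ} (hrn : r ≤ n) (σ : Equiv.Perm (Fin r))
    (lam : YoungDiagram) (hlam : lam.card = n) :
    Seminormal.totalSum lam (Seminormal.incl hrn σ) =
      ∑ τ : Equiv.Perm (Fin r),
        Seminormal.plancherelExp r
            (fun ν => Seminormal.normChar ν τ * Seminormal.totalSum ν σ) *
          Seminormal.normChar lam (Seminormal.incl hrn τ) := by
  open Seminormal in
  have e : ∀ τ : Equiv.Perm (Fin r),
      plancherelExp r (fun ν => normChar ν τ * totalSum ν σ) * normChar lam (incl hrn τ) =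
        (∑ q : Quotient (tailSetoid lam n r), ∑ κ : DiagramOfSize r,
          (repMatrix κ.1 τ).trace * (∑ U, ∑ V, repMatrix κ.1 σ U V) / r.factorial *
            (repMatrix (truncation q.out r) τ).trace) / (dim lam : ℝ) := by
    intro τ
    unfold plancherelExp
    rw [Finset.sum_congr rfl fun κ _ => plancherel_weight κ.1 κ.2 σ τ, normChar,
      trace_repMatrix_incl, ← mul_div_assoc, Finset.sum_mul_sum, Finset.sum_comm]
  rw [Finset.sum_congr rfl fun τ _ => e τ, ← Finset.sum_div, Finset.sum_comm,
    Seminormal.totalSum, Seminormal.sum_repMatrix_incl]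
  congr 1
  refine Finset.sum_congr rfl fun q _ => ?_
  rw [Finset.sum_comm]
  refine (Seminormal.sum_trace_mul_sum σ ?_ (Seminormal.card_truncation _ hrn)).symm
  -- The first `r` entries of the representative themselves form a standard tableau of the truncated
  -- shape, the witness that the dimension is nonzero.
  exact Seminormal.SYT.ofFilling ((Seminormal.sameTail_refl q.out).restrict hrn)
    (Seminormal.isStandard_of_le fun i j hij => q.out.isStandard.le hij)
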